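/- Notation. For integers $a_i\ge 1$ write $[a_1,a_2,\dots]=\cfrac{1}{a_1+\cfrac{1}{a_2+\cdots}}$ for a (finite or infinite) regular continued fraction; a rational in $(0,1)$ is always expanded in reduced form $[a_1,\dots,a_n]$ with $a_n\ge 2$. The Minkowski question mark measure $\mu_?$ on $[0,1)$ is the measure with distribution function $?(x)=2\sum_{i\ge 1}\frac{(-1)^{i+1}}{2^{a_1(x)+\cdots+a_i(x)}}$, where $a_i(x)$ are the continued fraction digits of $x\in[0,1)$ (the sum being finite for rational $x$). For a block $d=d_1,\dots,d_k$ of positive integers, $k\ge 1$, let $\Delta(d)=\{y\in[0,1): y=[d_1,\dots,d_k,\dots]\}$, and let $G_n(x,d)$ be the number of occurrences of $d$ in the first $n$ continued fraction digits of $x$. A number $x\in[0,1)$ is Minkowski normal if for every such block $d$ $$\lim_{n\to\infty}\frac1n G_n(x,d)=\mu_?(\Delta(d))=2^{-(d_1+\cdots+d_k)}.$$ The Kepler tree is the binary tree of rationals with root $1/2$ (level $0$) in which $p/q$ (in lowest terms) has left child $p/(p+q)$ and right child $q/(p+q)$; its level $l$ consists of $2^l$ rationals. Let $\kappa^l_1,\dots,\kappa^l_{2^l}$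 be the continued fraction expansions of the rationals in level $l$, ordered from left to right. Theorem. For every $l$ let $\pi_l$ be an arbitrary permutation of $\{1,\dots,2^l\}$. Then the infinite continued fraction obtained by concatenation, $$\mathcal K^{\pi}=[\kappa^1_{\pi_1(1)},\ \kappa^1_{\pi_1(2)},\ \kappa^2_{\pi_2(1)},\ \kappa^2_{\pi_2(2)},\ \kappa^2_{\pi_2(3)},\ \kappa^2_{\pi_2(4)},\ \kappa^3_{\pi_3(1)},\ \dots],$$ converges to a real number whose continued fraction expansion is this concatenation, and this number is Minkowski normal. The same holds for the number obtained by placing the expansion $[2]$ of the root $1/2$ in front, that is, $[2,\ \kappa^1_{\pi_1(1)},\ \kappa^1_{\pi_1(2)},\ \kappa^2_{\pi_2(1)},\ \dots]$. -/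

import Mathlib

open Filter Topology MeasureTheory

/-! ### Continued fraction digits -/

/-- The digit `a_{i+1}(x)` of the regular continued fraction expansion of `x` (indexing starts at
`i = 0`, the integer part is not counted); `none` if the expansion of `x` has at most `i` digits.
The expansion of a rational is the reduced one, whose last digit is at least `2`. -/
noncomputable def cfDigit (x : ℝ) (i : ℕ) : Option ℕ :=
  ((GenContFract.of x).partDens.get? i).map fun b => ⌊b⌋₊

theorem cf_terminates_of_rat (q : ℚ) : (GenContFract.of q).s.Terminates :=
  GenContFract.terminates_of_rat q

/-- The list `a_1, …, a_n` of continued fraction digits of a rational number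
(without the integer part), in reduced form. -/
noncomputable def cfExpansion (q : ℚ) : List ℕ :=
  ((GenContFract.of q).s.toList (cf_terminates_of_rat q)).map fun p => ⌊p.b⌋₊

/-- The formal infinite continued fraction `[a_1, a_2, …]` with zero integer part; here
`a i` stands for `a_{i+1}`. -/
def infiniteCF (a : ℕ → ℕ) : GenContFract ℝ :=
  ⟨0, Stream'.Seq.ofStream fun n => ⟨1, (a n : ℝ)⟩⟩

/-- The cylinder set of all `y ∈ [0, 1)` whose expansion starts with the block `d`. -/
def cfCylinder (d : List ℕ) : Set ℝ :=
  {y | y ∈ Set.Ico (0 : ℝ) 1 ∧ ∀ t < d.length, cfDigit y t = d[t]?}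

open Classical in
/-- The number of occurrences of the block `d` inside the first `n` continued fraction digits
of `x`. -/
noncomputable def blockCount (x : ℝ) (d : List ℕ) (n : ℕ) : ℕ :=
  ((Finset.range n).filter fun j =>
    j + d.length ≤ n ∧ ∀ t < d.length, cfDigit x (j + t) = d[t]?).card

/-! ### The Minkowski question mark function and measure -/

/-- The summand `(-1)^i / 2^(a_1(x) + ⋯ + a_{i+1}(x))`, which is `0` when the expansion of `x` has
at most `i` digits. -/
noncomputable def questionMarkTerm (x : ℝ) (i : ℕ) : ℝ :=
  if (cfDigit x i).isSome then
    (-1) ^ i / 2 ^ (∑ j ∈ Finset.range (i + 1), (cfDigit x j).getD 0)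
  else 0

/-- The Minkowski question mark function: the usual alternating series on `[0, 1)`, extended by `0`
to the left and by `1` to the right, as for the distribution function of a measure on `[0, 1)`. -/
noncomputable def questionMark (x : ℝ) : ℝ :=
  if x < 0 then 0 else if 1 ≤ x then 1 else 2 * ∑' i, questionMarkTerm x i

theorem cfDigit_zero_of_fract_eq {x : ℝ} (hx : Int.fract x = 0) (i : ℕ) : cfDigit x i = none := by
  obtain ⟨a, rfl⟩ : ∃ a : ℤ, x = a := ⟨⌊x⌋, eq_of_sub_eq_zero hx⟩
  simp [cfDigit, GenContFract.partDens, GenContFract.of_s_of_int]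

theorem cfDigit_fract (x : ℝ) (i : ℕ) : cfDigit (Int.fract x) i = cfDigit x i := by
  by_cases hx : Int.fract x = 0
  · rw [cfDigit_zero_of_fract_eq hx, cfDigit_zero_of_fract_eq (by simp [hx])]
  have hx' : Int.fract (Int.fract x) ≠ 0 := by simpa using hx
  cases i with
  | zero =>
    have h1 := GenContFract.of_s_head hx
    have h2 := GenContFract.of_s_head hx'
    simp only [Stream'.Seq.head, Int.fract_fract] at h1 h2
    simp [cfDigit, GenContFract.partDens, h1, h2]
  | succ n =>
    simp only [cfDigit, GenContFract.partDens, Stream'.Seq.map_get?, GenContFract.of_s_succ,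
      Int.fract_fract]

theorem cfDigit_head {x : ℝ} (h0 : 0 < x) (h1 : x < 1) : cfDigit x 0 = some ⌊x⁻¹⌋₊ := by
  have hf : Int.fract x = x := Int.fract_eq_self.2 ⟨h0.le, h1⟩
  have h := GenContFract.of_s_head (v := x) (by rw [hf]; exact h0.ne')
  simp only [Stream'.Seq.head, hf] at h
  have hn : (0 : ℝ) ≤ x⁻¹ := (inv_pos.2 h0).le
  simp [cfDigit, GenContFract.partDens, h, ← natCast_floor_eq_intCast_floor hn]

theorem cfDigit_tail {x : ℝ} (h0 : 0 < x) (h1 : x < 1) (i : ℕ) :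
    cfDigit x (i + 1) = cfDigit (Int.fract x⁻¹) i := by
  have hf : Int.fract x = x := Int.fract_eq_self.2 ⟨h0.le, h1⟩
  rw [cfDigit_fract]
  simp only [cfDigit, GenContFract.partDens, Stream'.Seq.map_get?, GenContFract.of_s_succ, hf]

theorem questionMarkTerm_head {x : ℝ} (h0 : 0 < x) (h1 : x < 1) :
    questionMarkTerm x 0 = 1 / 2 ^ ⌊x⁻¹⌋₊ := by
  simp [questionMarkTerm, cfDigit_head h0 h1]

theorem questionMarkTerm_tail {x : ℝ} (h0 : 0 < x) (h1 : x < 1) (i : ℕ) :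
    questionMarkTerm x (i + 1) = -(1 / 2 ^ ⌊x⁻¹⌋₊) * questionMarkTerm (Int.fract x⁻¹) i := by
  unfold questionMarkTerm
  rw [cfDigit_tail h0 h1]
  split_ifs with h
  · rw [Finset.sum_range_succ' _ (i + 1), cfDigit_head h0 h1, pow_add, pow_succ]
    simp only [cfDigit_tail h0 h1, Option.getD_some, div_eq_mul_inv]
    ring
  · simp

theorem one_le_floor_inv {x : ℝ} (h0 : 0 < x) (h1 : x < 1) : 1 ≤ ⌊x⁻¹⌋₊ :=
  Nat.le_floor (by simpa using (one_lt_inv₀ h0).2 h1 |>.le)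

theorem two_inv_pow_floor_le {x : ℝ} (h0 : 0 < x) (h1 : x < 1) :
    (1 : ℝ) / 2 ^ ⌊x⁻¹⌋₊ ≤ 1 / 2 := by
  have := pow_le_pow_right₀ (one_le_two : (1 : ℝ) ≤ 2) (one_le_floor_inv h0 h1)
  gcongr
  simpa using this

theorem questionMarkTerm_zero (i : ℕ) : questionMarkTerm 0 i = 0 := by
  simp [questionMarkTerm, cfDigit_zero_of_fract_eq]

theorem abs_questionMarkTerm_le (i : ℕ) :
    ∀ x : ℝ, 0 ≤ x → x < 1 → |questionMarkTerm x i| ≤ (1 / 2) ^ (i + 1) := by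
  induction i with
  | zero =>
    intro x h0 h1
    rcases h0.eq_or_lt with rfl | h0
    · simp [questionMarkTerm_zero]
    · rw [questionMarkTerm_head h0 h1, abs_of_nonneg (by positivity)]
      simpa using two_inv_pow_floor_le h0 h1
  | succ n ih =>
    intro x h0 h1
    rcases h0.eq_or_lt with rfl | h0
    · simp [questionMarkTerm_zero]
    · rw [questionMarkTerm_tail h0 h1, abs_mul, abs_neg, abs_of_nonneg (by positivity), pow_succ']
      exact mul_le_mul (two_inv_pow_floor_le h0 h1)
        (ih _ (Int.fract_nonneg _) (Int.fract_lt_one _)) (abs_nonneg _) (by norm_num)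

theorem summable_questionMarkTerm {x : ℝ} (h0 : 0 ≤ x) (h1 : x < 1) :
    Summable (questionMarkTerm x) := by
  refine Summable.of_norm_bounded
    (g := fun i : ℕ => (1 / 2 : ℝ) ^ (i + 1)) ?_ fun i => ?_
  · exact (summable_nat_add_iff 1).2 summable_geometric_two
  · exact abs_questionMarkTerm_le i x h0 h1

theorem questionMark_zero : questionMark 0 = 0 := by
  simp [questionMark, questionMarkTerm_zero]

theorem questionMark_rec {x : ℝ} (h0 : 0 < x) (h1 : x < 1) :
    questionMark x = 1 / 2 ^ ⌊x⁻¹⌋₊ * (2 - questionMark (Int.fract x⁻¹)) := by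
  have hf0 := Int.fract_nonneg x⁻¹
  have hf1 := Int.fract_lt_one x⁻¹
  rw [questionMark, if_neg h0.not_gt, if_neg h1.not_ge, questionMark, if_neg hf0.not_gt,
    if_neg hf1.not_ge, (summable_questionMarkTerm h0.le h1).tsum_eq_zero_add,
    questionMarkTerm_head h0 h1]
  simp only [questionMarkTerm_tail h0 h1, tsum_mul_left]
  ring

theorem questionMark_bounds_aux (n : ℕ) : ∀ x : ℝ, 0 ≤ x → x < 1 →
    -(4 * (1 / 2) ^ n) ≤ questionMark x ∧ questionMark x ≤ 1 + 4 * (1 / 2) ^ n := by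
  induction n with
  | zero =>
    intro x h0 h1
    have hs := summable_questionMarkTerm h0 h1
    have hg : Summable fun i : ℕ => (1 / 2 : ℝ) ^ (i + 1) :=
      (summable_nat_add_iff 1).2 summable_geometric_two
    have hsum : ∑' i : ℕ, (1 / 2 : ℝ) ^ (i + 1) = 1 := by
      simp only [pow_succ, tsum_mul_right, tsum_geometric_two]; norm_num
    have hb : |∑' i, questionMarkTerm x i| ≤ 1 := by
      rw [← hsum, ← Real.norm_eq_abs]
      exact tsum_of_norm_bounded hg.hasSum fun i => abs_questionMarkTerm_le i x h0 h1
    rw [questionMark, if_neg h0.not_gt, if_neg h1.not_ge]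
    constructor <;> linarith [abs_le.1 hb]
  | succ n ih =>
    intro x h0 h1
    have hp : (0 : ℝ) < (1 / 2) ^ n := by positivity
    rcases h0.eq_or_lt with rfl | h0
    · rw [questionMark_zero]
      constructor <;> linarith [show (0 : ℝ) < (1 / 2) ^ (n + 1) by positivity]
    · rw [questionMark_rec h0 h1, pow_succ]
      obtain ⟨hl, hu⟩ := ih _ (Int.fract_nonneg x⁻¹) (Int.fract_lt_one x⁻¹)
      have hc := two_inv_pow_floor_le h0 h1
      have hc0 : (0 : ℝ) < 1 / 2 ^ ⌊x⁻¹⌋₊ := by positivity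
      constructor <;> nlinarith

theorem tendsto_four_mul_half_pow : Tendsto (fun n : ℕ => 4 * (1 / 2 : ℝ) ^ n) atTop (𝓝 0) := by
  simpa using (tendsto_pow_atTop_nhds_zero_of_lt_one (r := (1 / 2 : ℝ)) (by norm_num)
    (by norm_num)).const_mul 4

theorem questionMark_mem_Icc (x : ℝ) : 0 ≤ questionMark x ∧ questionMark x ≤ 1 := by
  by_cases h0 : x < 0
  · simp [questionMark, h0]
  by_cases h1 : 1 ≤ x
  · simp [questionMark, h0, h1]
  have hb := fun n => questionMark_bounds_aux n x (not_lt.1 h0) (not_le.1 h1)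
  refine ⟨?_, ?_⟩
  · exact le_of_tendsto' (by simpa using tendsto_four_mul_half_pow.neg) fun n => (hb n).1
  · exact ge_of_tendsto' (by simpa using tendsto_four_mul_half_pow.const_add 1) fun n => (hb n).2

theorem questionMark_mono_aux (n : ℕ) : ∀ x y : ℝ, 0 ≤ x → x ≤ y → y < 1 →
    questionMark x ≤ questionMark y + 4 * (1 / 2) ^ n := by
  induction n with
  | zero =>
    intro x y _ _ _
    linarith [(questionMark_mem_Icc x).2, (questionMark_mem_Icc y).1]
  | succ n ih =>
    intro x y hx hxy hy
    have hp : (0 : ℝ) < (1 / 2) ^ n := by positivity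
    rcases hx.eq_or_lt with rfl | hx
    · rw [questionMark_zero, pow_succ]
      linarith [(questionMark_mem_Icc y).1]
    have hy0 : 0 < y := hx.trans_le hxy
    have hx1 : x < 1 := hxy.trans_lt hy
    have hinv : y⁻¹ ≤ x⁻¹ := inv_anti₀ hx hxy
    have hfl : ⌊y⁻¹⌋₊ ≤ ⌊x⁻¹⌋₊ := Nat.floor_mono hinv
    rw [questionMark_rec hx hx1, questionMark_rec hy0 hy, pow_succ]
    have hc := two_inv_pow_floor_le hx hx1
    have hc0 : (0 : ℝ) < 1 / 2 ^ ⌊x⁻¹⌋₊ := by positivity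
    rcases hfl.eq_or_lt with h | h
    · have hn : (⌊y⁻¹⌋ : ℝ) = ⌊x⁻¹⌋ := by
        rw [← natCast_floor_eq_intCast_floor (inv_pos.2 hy0).le,
          ← natCast_floor_eq_intCast_floor (inv_pos.2 hx).le, h]
      have hfr : Int.fract y⁻¹ ≤ Int.fract x⁻¹ := by
        unfold Int.fract; linarith
      have := ih _ _ (Int.fract_nonneg _) hfr (Int.fract_lt_one _)
      rw [h]
      nlinarith
    · have hle : (1 : ℝ) / 2 ^ ⌊x⁻¹⌋₊ * 2 ≤ 1 / 2 ^ ⌊y⁻¹⌋₊ := by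
        have := pow_le_pow_right₀ (one_le_two : (1 : ℝ) ≤ 2) (Nat.succ_le_of_lt h)
        rw [pow_succ] at this
        rw [div_mul_eq_mul_div, div_le_div_iff₀ (by positivity) (by positivity)]
        linarith
      have hd0 : (0 : ℝ) < 1 / 2 ^ ⌊y⁻¹⌋₊ := by positivity
      have hX := questionMark_mem_Icc (Int.fract x⁻¹)
      have hY := questionMark_mem_Icc (Int.fract y⁻¹)
      nlinarith

theorem questionMark_monotone : Monotone questionMark := by
  intro x y hxy
  by_cases hx : x < 0
  · simpa [questionMark, hx] using (questionMark_mem_Icc y).1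
  by_cases hy : 1 ≤ y
  · have hy0 : ¬ y < 0 := by linarith
    simpa [questionMark, hy, hy0] using (questionMark_mem_Icc x).2
  exact ge_of_tendsto' (by simpa using tendsto_four_mul_half_pow.const_add (questionMark y))
    fun n => questionMark_mono_aux n x y (not_lt.1 hx) hxy (not_le.1 hy)

/-- The Minkowski question mark measure: the Lebesgue–Stieltjes measure with distribution function
`questionMark`. (Mathlib passes to right limits here; this changes nothing, as the question mark
function is continuous.) -/
noncomputable def minkowskiMeasure : Measure ℝ :=
  questionMark_monotone.stieltjesFunction.measure

/-! ### Minkowski normality -/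

/-- `x ∈ [0, 1)` is Minkowski normal if every nonempty block `d` of positive integers occurs in its
continued fraction expansion with asymptotic frequency `μ_?(Δ(d)) = 2^{-(d_1 + ⋯ + d_k)}`. -/
def IsMinkowskiNormal (x : ℝ) : Prop :=
  x ∈ Set.Ico (0 : ℝ) 1 ∧
    ∀ d : List ℕ, d ≠ [] → (∀ a ∈ d, 1 ≤ a) →
      Tendsto (fun n : ℕ => (blockCount x d n : ℝ) / n) atTop
          (𝓝 (minkowskiMeasure.real (cfCylinder d))) ∧
        minkowskiMeasure.real (cfCylinder d) = 1 / 2 ^ d.sum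

/-! ### The Kepler tree and the permuted concatenation -/

/-- The rational at position `j` (counted from the left, starting at `0`, so `j < 2 ^ l`) of level
`l` of the Kepler tree: the root is `1/2`, and `p/q` has left child `p/(p+q)` and right child
`q/(p+q)`. -/
def keplerNode : ℕ → ℕ → ℚ
  | 0, _ => 1 / 2
  | l + 1, j =>
    let r := keplerNode l (j / 2)
    if j % 2 = 0 then (r.num : ℚ) / (r.num + r.den) else (r.den : ℚ) / (r.num + r.den)

/-- The concatenation `κ^l_{π_l(1)}, …, κ^l_{π_l(2^l)}` of the continued fraction expansions of the
rationals in level `l` of the Kepler tree, in the order given by `π l`. -/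
noncomputable def keplerLevelWord (π : ∀ l : ℕ, Equiv.Perm (Fin (2 ^ l))) (l : ℕ) : List ℕ :=
  (List.finRange (2 ^ l)).flatMap fun j => cfExpansion (keplerNode l (π l j))

/-- The digit at position `n` (starting at `0`) of the infinite concatenation of the words of
levels `s, s + 1, s + 2, …`. Each level contributes at least one digit, so the first `n + 1` of
these words determine it and the default value is never used. -/
noncomputable def keplerDigits (π : ∀ l : ℕ, Equiv.Perm (Fin (2 ^ l))) (s n : ℕ) : ℕ :=
  ((List.range (n + 1)).flatMap fun i => keplerLevelWord π (s + i)).getD n 0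

/-! ### Continued fraction digits of `1 / (a + y)` -/

/-! On expansions, passing to a child in the Kepler tree is a coin toss: the word `a :: t` becomes
`(a + 1) :: t` or `1 :: a :: t` (`keplerWord_succ`). A uniformly chosen word of level `l` is thus
the end of a fair random walk with `l` steps, in which new digits appear on the left.

Fix a block `d` and put `p = 2^{-(d_1 + ⋯ + d_k)}`. The number of occurrences of `d` minus `p` times
the length differs by a bounded amount from a martingale `M` with increments at most `1`
(`exists_occ_martingale`). Orthogonality of the increments bounds the mean of `M ^ 2` over level `l`
by `l + 1` (`sum_sq_martingale_le`), so by Cauchy–Schwarz the mean absolute deviation over the level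
is `O(√l)`, while the mean length is `(l + 2) / 2`.

This is an L¹ estimate on single words, so it ignores their order, and it also bounds the
contribution of any part of a level. Joining words costs at most `d.length` occurrences per
junction, and cutting the last word costs at most its length (`abs_occ_take_flatten_le`). A prefix
of length `n` that ends near level `l` therefore has relative error `O(1/√l)`, whatever the
permutations (`abs_occ_keplerDigits_sub_le`).

Two facts about continued fractions complete the argument. Every sequence of positive digits is the
expansion of a real number in `[0, 1)` (`exists_cfDigit_eq`). The measure of a cylinder is `p`,
because putting a digit `a` in front reflects the values of the question mark function and scales
them by `2^{-a}` (`minkowskiMeasure_cfCylinder`). -/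

theorem floor_fract_add_of_mem_Ico (a : ℕ) {y : ℝ} (h0 : 0 ≤ y) (h1 : y < 1) :
    ⌊(a + y : ℝ)⌋₊ = a ∧ Int.fract (a + y : ℝ) = y := by
  constructor
  · rw [add_comm, Nat.floor_add_natCast h0, Nat.floor_eq_zero.2 h1, zero_add]
  · rw [Int.fract_natCast_add, Int.fract_eq_self.2 ⟨h0, h1⟩]

theorem one_div_add_mem_Ioc {a : ℕ} (ha : 1 ≤ a) {y : ℝ} (h0 : 0 ≤ y) :
    0 < 1 / (a + y : ℝ) ∧ 1 / (a + y : ℝ) ≤ 1 := by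
  have ha' : (1 : ℝ) ≤ a := by exact_mod_cast ha
  exact ⟨by positivity, by rw [div_le_one (by positivity)]; linarith⟩

theorem one_div_add_lt_one {a : ℕ} (ha : 1 ≤ a) {y : ℝ} (h0 : 0 < y) :
    1 / (a + y : ℝ) < 1 := by
  have ha' : (1 : ℝ) ≤ a := by exact_mod_cast ha
  rw [div_lt_one (by positivity)]; linarith

theorem natCast_floor_add_fract {x : ℝ} (hx : 0 ≤ x) : (⌊x⌋₊ : ℝ) + Int.fract x = x := by
  rw [natCast_floor_eq_intCast_floor hx, Int.floor_add_fract]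

/-! ### The question mark function and the measure of cylinders -/

theorem questionMark_one : questionMark 1 = 1 := by simp [questionMark]

theorem questionMark_one_div_add {a : ℕ} (ha : 1 ≤ a) {y : ℝ} (h0 : 0 ≤ y) (h1 : y ≤ 1) :
    questionMark (1 / (a + y)) = 1 / 2 ^ a * (2 - questionMark y) := by
  obtain ⟨hp, hle⟩ := one_div_add_mem_Ioc ha h0
  rcases h1.eq_or_lt with rfl | h1
  -- At `y = 1` the first digit is `a + 1` and the remainder is `0`; both formulas agree because
  -- `2^{-(a+1)} * 2 = 2^{-a} * (2 - 1)`.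
  · have hlt := one_div_add_lt_one ha one_pos
    obtain ⟨hf, hr⟩ := floor_fract_add_of_mem_Ico (a + 1) le_rfl one_pos
    rw [questionMark_rec hp hlt, one_div (a + 1 : ℝ), inv_inv, show (a + 1 : ℝ) = ((a + 1 : ℕ) : ℝ) + 0 by simp,
      hf, hr, questionMark_zero, questionMark_one, pow_succ]
    field_simp
    norm_num
  · rcases hle.eq_or_lt with h | hlt
    · have ha' : (1 : ℝ) ≤ a := by exact_mod_cast ha
      have : (a : ℝ) + y = 1 := by field_simp at h; linarith
      have hy : y = 0 := by linarith
      have ha1 : a = 1 := by exact_mod_cast (by linarith : (a : ℝ) = 1)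
      simp [hy, ha1, questionMark_one, questionMark_zero]
    · obtain ⟨hf, hr⟩ := floor_fract_add_of_mem_Ico a h0 h1
      rw [questionMark_rec hp hlt, one_div (a + y : ℝ), inv_inv, hf, hr]

/-- Solving `?(1 / (a + x)) = t` for `?(x)` multiplies the error by `2^{-a} ≤ 1/2`, so each digit
gains a factor of two. The dense range obtained in this way makes the monotone function continuous.
-/
theorem exists_questionMark_approx (n : ℕ) : ∀ t : ℝ, 0 ≤ t → t ≤ 1 →
    ∃ x : ℝ, 0 ≤ x ∧ x ≤ 1 ∧ |questionMark x - t| ≤ (1 / 2) ^ n := by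
  induction n with
  | zero =>
    intro t h0 h1
    exact ⟨0, le_rfl, zero_le_one, by rw [questionMark_zero, abs_le]; constructor <;> norm_num <;> linarith⟩
  | succ n ih =>
    intro t h0 h1
    rcases h0.eq_or_lt with rfl | h0
    · exact ⟨0, le_rfl, zero_le_one, by rw [questionMark_zero]; simp⟩
    -- The first digit is `a + 1`, where `(1/2)^(a+1) < t ≤ (1/2)^a`; this is what puts the new
    -- target `2 - t * 2^(a+1)` into `[0, 1]`.
    obtain ⟨a, ha1, ha2⟩ := exists_nat_pow_near_of_lt_one h0 h1 (by norm_num : (0 : ℝ) < 1 / 2)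
      (by norm_num)
    have hp : (0 : ℝ) < (1 / 2) ^ (a + 1) := by positivity
    have hinv : (1 / 2 : ℝ) ^ (a + 1) * 2 ^ (a + 1) = 1 := by rw [← mul_pow]; norm_num
    obtain ⟨x, hx0, hx1, hx⟩ := ih (2 - t * 2 ^ (a + 1))
      (by rw [pow_succ (1 / 2 : ℝ)] at hinv
          have : (0:ℝ) < 2 ^ (a + 1) := by positivity
          nlinarith)
      (by have : (0:ℝ) < 2 ^ (a + 1) := by positivity
          nlinarith)
    obtain ⟨q0, q1⟩ := one_div_add_mem_Ioc (Nat.succ_pos a) hx0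
    refine ⟨_, q0.le, q1, ?_⟩
    rw [questionMark_one_div_add (Nat.succ_pos a) hx0 hx1]
    have : 1 / 2 ^ (a + 1) * (2 - questionMark x) - t =
        -((1 / 2) ^ (a + 1) * (questionMark x - (2 - t * 2 ^ (a + 1)))) := by
      rw [one_div_pow]; field_simp; ring
    rw [this, abs_neg, abs_mul, abs_of_pos hp, pow_succ' (1 / 2 : ℝ) n]
    have h2 : (1 / 2 : ℝ) ^ (a + 1) ≤ 1 / 2 := by
      simpa using pow_le_pow_of_le_one (by norm_num : (0:ℝ) ≤ 1/2) (by norm_num) (Nat.succ_pos a)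
    exact mul_le_mul h2 hx (abs_nonneg _) (by norm_num)

theorem questionMark_continuous : Continuous questionMark := by
  let f : ℝ → Set.Icc (0 : ℝ) 1 := fun x => ⟨questionMark x, questionMark_mem_Icc x⟩
  have hf : Monotone f := fun x y h => questionMark_monotone h
  have hd : DenseRange f := by
    rw [DenseRange, Metric.dense_iff]
    rintro ⟨t, h0, h1⟩ r hr
    obtain ⟨n, hn⟩ := exists_pow_lt_of_lt_one hr (by norm_num : (1 / 2 : ℝ) < 1)
    obtain ⟨x, -, -, hx⟩ := exists_questionMark_approx n t h0 h1
    exact ⟨f x, by simpa [Subtype.dist_eq, Real.dist_eq, f] using hx.trans_lt hn, x, rfl⟩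
  exact continuous_subtype_val.comp (hf.continuous_of_denseRange hd)

/-! ### The Minkowski measure of intervals and cylinders -/

theorem stieltjesFunction_questionMark (x : ℝ) :
    questionMark_monotone.stieltjesFunction x = questionMark x := by
  rw [Monotone.stieltjesFunction_eq]
  exact questionMark_continuous.continuousAt.continuousWithinAt.rightLim_eq

theorem leftLim_stieltjesFunction_questionMark (x : ℝ) :
    Function.leftLim questionMark_monotone.stieltjesFunction x = questionMark x := by
  rw [show (questionMark_monotone.stieltjesFunction : ℝ → ℝ) = questionMark from
    funext stieltjesFunction_questionMark]
  exact questionMark_continuous.continuousAt.continuousWithinAt.leftLim_eq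

theorem minkowskiMeasure_Icc (u v : ℝ) :
    minkowskiMeasure (Set.Icc u v) = ENNReal.ofReal (questionMark v - questionMark u) := by
  rw [minkowskiMeasure, StieltjesFunction.measure_Icc, leftLim_stieltjesFunction_questionMark,
    stieltjesFunction_questionMark]

theorem minkowskiMeasure_Ioo (u v : ℝ) :
    minkowskiMeasure (Set.Ioo u v) = ENNReal.ofReal (questionMark v - questionMark u) := by
  rw [minkowskiMeasure, StieltjesFunction.measure_Ioo, leftLim_stieltjesFunction_questionMark,
    stieltjesFunction_questionMark]

theorem mem_cfCylinder_cons_iff {a : ℕ} {d : List ℕ} {y : ℝ} :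
    y ∈ cfCylinder (a :: d) ↔
      0 < y ∧ y < 1 ∧ ⌊y⁻¹⌋₊ = a ∧ Int.fract y⁻¹ ∈ cfCylinder d := by
  simp only [cfCylinder, Set.mem_ofPred_eq, Set.mem_Ico, List.length_cons]
  constructor
  · rintro ⟨⟨h0, h1⟩, h⟩
    rcases h0.eq_or_lt with rfl | h0
    · simpa [cfDigit_zero_of_fract_eq] using h 0 (Nat.succ_pos _)
    refine ⟨h0, h1, ?_, ⟨Int.fract_nonneg _, Int.fract_lt_one _⟩, fun t ht => ?_⟩
    · simpa [cfDigit_head h0 h1] using h 0 (Nat.succ_pos _)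
    · simpa [cfDigit_tail h0 h1] using h (t + 1) (by omega)
  · rintro ⟨h0, h1, ha, -, h⟩
    refine ⟨⟨h0.le, h1⟩, fun t ht => ?_⟩
    cases t with
    | zero => simp [cfDigit_head h0 h1, ha]
    | succ t => simpa [cfDigit_tail h0 h1] using h t (by omega)

/-- A cylinder is an interval up to its endpoints. Which endpoints belong to it is irrelevant, since
the distribution function is continuous and points have measure zero. -/
theorem exists_Ioo_subset_cfCylinder_subset_Icc (d : List ℕ) (hd : ∀ a ∈ d, 1 ≤ a) :
    ∃ u v : ℝ, 0 ≤ u ∧ u ≤ v ∧ v ≤ 1 ∧ Set.Ioo u v ⊆ cfCylinder d ∧ cfCylinder d ⊆ Set.Icc u v ∧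
      questionMark v - questionMark u = 1 / 2 ^ d.sum := by
  induction d with
  | nil =>
    refine ⟨0, 1, le_rfl, zero_le_one, le_rfl, ?_, ?_, ?_⟩
    · intro y hy
      exact ⟨⟨hy.1.le, hy.2⟩, by simp⟩
    · intro y hy
      exact ⟨hy.1.1, hy.1.2.le⟩
    · simp [questionMark_zero, questionMark_one]
  | cons a d ih =>
    obtain ⟨u, v, hu, huv, hv, h1, h2, h3⟩ := ih fun b hb => hd b (List.mem_cons_of_mem _ hb)
    have ha : 1 ≤ a := hd a List.mem_cons_self
    have ha' : (1 : ℝ) ≤ a := by exact_mod_cast ha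
    have hu1 := one_div_add_mem_Ioc ha hu
    have hv1 := one_div_add_mem_Ioc ha (hu.trans huv)
    refine ⟨1 / (a + v), 1 / (a + u), hv1.1.le, by gcongr, hu1.2, ?_, ?_, ?_⟩
    · rintro y ⟨hy1, hy2⟩
      have hy0 : 0 < y := hv1.1.trans hy1
      have e1 : y⁻¹ < a + v := by
        rw [inv_lt_comm₀ hy0 (by linarith)]; simpa using hy1
      have e2 : a + u < y⁻¹ := by
        rw [lt_inv_comm₀ (by linarith) hy0]; simpa using hy2
      obtain ⟨hf, hr⟩ := floor_fract_add_of_mem_Ico a (y := y⁻¹ - a) (by linarith) (by linarith)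
      rw [add_sub_cancel] at hf hr
      rw [mem_cfCylinder_cons_iff]
      refine ⟨hy0, hy2.trans_le hu1.2, hf, h1 ?_⟩
      rw [hr]
      constructor <;> linarith
    · intro y hy
      rw [mem_cfCylinder_cons_iff] at hy
      obtain ⟨hy0, hy1, hf, hr⟩ := hy
      have he := natCast_floor_add_fract (inv_pos.2 hy0).le
      rw [hf] at he
      obtain ⟨r1, r2⟩ := h2 hr
      have hyy : 1 / (a + Int.fract y⁻¹) = y := by rw [he, one_div, inv_inv]
      have := Int.fract_nonneg y⁻¹
      rw [← hyy]
      constructor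
      · exact one_div_le_one_div_of_le (by linarith) (by linarith)
      · exact one_div_le_one_div_of_le (by linarith) (by linarith)
    · rw [questionMark_one_div_add ha hu (huv.trans hv),
        questionMark_one_div_add ha (hu.trans huv) hv, List.sum_cons, pow_add, ← mul_sub,
        sub_sub_sub_cancel_left, h3]
      field_simp

theorem minkowskiMeasure_cfCylinder (d : List ℕ) (hd : ∀ a ∈ d, 1 ≤ a) :
    minkowskiMeasure.real (cfCylinder d) = 1 / 2 ^ d.sum := by
  obtain ⟨u, v, -, -, -, h1, h2, h3⟩ := exists_Ioo_subset_cfCylinder_subset_Icc d hd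
  have : minkowskiMeasure (cfCylinder d) = ENNReal.ofReal (1 / 2 ^ d.sum) := by
    apply le_antisymm
    · rw [← h3, ← minkowskiMeasure_Icc]; exact measure_mono h2
    · rw [← h3, ← minkowskiMeasure_Ioo]; exact measure_mono h1
  rw [Measure.real, this, ENNReal.toReal_ofReal (by positivity)]

/-! ### Infinite continued fractions with prescribed digits -/

/-- The finite continued fraction `[a_1, …, a_n]`. -/
noncomputable def cfApprox : ℕ → (ℕ → ℕ) → ℝ
  | 0, _ => 0
  | n + 1, a => 1 / (a 0 + cfApprox n fun i => a (i + 1))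

theorem cfApprox_mem_Icc (n : ℕ) : ∀ a : ℕ → ℕ, (∀ i, 1 ≤ a i) →
    0 ≤ cfApprox n a ∧ cfApprox n a ≤ 1 := by
  induction n with
  | zero => intro a _; simp [cfApprox]
  | succ n ih =>
    intro a ha
    obtain ⟨h1, h2⟩ := one_div_add_mem_Ioc (ha 0) (ih (fun i => a (i + 1)) fun i => ha _).1
    exact ⟨h1.le, h2⟩

/-- A single step `y ↦ 1 / (a + y)` need not contract by a uniform factor (take `a = 1` and `y` near
`0`). Two steps do, since both factors in the denominator of the difference are at least `2`. -/
theorem abs_two_step_sub_le {a b : ℕ} (ha : 1 ≤ a) (hb : 1 ≤ b) {y z : ℝ} (hy : 0 ≤ y)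
    (hz : 0 ≤ z) :
    |1 / (a + 1 / (b + y) : ℝ) - 1 / (a + 1 / (b + z) : ℝ)| ≤ 1 / 4 * |y - z| := by
  have ha' : (1 : ℝ) ≤ a := by exact_mod_cast ha
  have hb' : (1 : ℝ) ≤ b := by exact_mod_cast hb
  have e : 1 / (a + 1 / (b + y) : ℝ) - 1 / (a + 1 / (b + z) : ℝ) =
      (y - z) / ((a * (b + y) + 1) * (a * (b + z) + 1)) := by
    field_simp; ring
  have h1 : (2 : ℝ) ≤ a * (b + y) + 1 := by nlinarith
  have h2 : (2 : ℝ) ≤ a * (b + z) + 1 := by nlinarith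
  have h3 : (4 : ℝ) ≤ (a * (b + y) + 1) * (a * (b + z) + 1) := by nlinarith
  rw [e, abs_div, abs_of_pos (by linarith : (0 : ℝ) < (a * (b + y) + 1) * (a * (b + z) + 1)),
    div_eq_mul_inv, mul_comm]
  gcongr
  rw [one_div]
  gcongr

theorem abs_cfApprox_sub_le (N : ℕ) : ∀ (a : ℕ → ℕ), (∀ i, 1 ≤ a i) → ∀ n m : ℕ, 2 * N ≤ n →
    2 * N ≤ m → |cfApprox n a - cfApprox m a| ≤ (1 / 4) ^ N := by
  induction N with
  | zero =>
    intro a ha n m _ _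
    have h1 := cfApprox_mem_Icc n a ha
    have h2 := cfApprox_mem_Icc m a ha
    rw [pow_zero, abs_le]
    constructor <;> linarith
  | succ N ih =>
    intro a ha n m hn hm
    obtain ⟨n, rfl⟩ : ∃ k, n = k + 1 + 1 := ⟨n - 2, by omega⟩
    obtain ⟨m, rfl⟩ : ∃ k, m = k + 1 + 1 := ⟨m - 2, by omega⟩
    have hpos : ∀ i, 1 ≤ a (i + 1 + 1) := fun i => ha _
    simp only [cfApprox]
    refine (abs_two_step_sub_le (ha 0) (ha _) (cfApprox_mem_Icc n _ hpos).1
      (cfApprox_mem_Icc m _ hpos).1).trans ?_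
    rw [pow_succ']
    gcongr
    exact ih _ hpos n m (by omega) (by omega)

theorem exists_tendsto_cfApprox (a : ℕ → ℕ) (ha : ∀ i, 1 ≤ a i) :
    ∃ x, Tendsto (fun n => cfApprox n a) atTop (𝓝 x) := by
  refine cauchySeq_tendsto_of_complete (Metric.cauchySeq_iff.2 fun ε hε => ?_)
  obtain ⟨N, hN⟩ := exists_pow_lt_of_lt_one hε (by norm_num : (1 / 4 : ℝ) < 1)
  exact ⟨2 * N, fun n hn m hm => (abs_cfApprox_sub_le N a ha n m hn hm).trans_lt hN⟩

theorem exists_cfDigit_eq (a : ℕ → ℕ) (ha : ∀ i, 1 ≤ a i) :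
    ∃ x : ℝ, 0 ≤ x ∧ x < 1 ∧ ∀ n, cfDigit x n = some (a n) := by
  let shift : ℕ → ℕ → ℕ := fun k i => a (i + k)
  have hs : ∀ k i, 1 ≤ shift k i := fun k i => ha _
  choose f hf using fun k => exists_tendsto_cfApprox (shift k) (hs k)
  have hmem : ∀ k, 0 ≤ f k ∧ f k ≤ 1 := fun k =>
    ⟨ge_of_tendsto' (hf k) fun n => (cfApprox_mem_Icc n _ (hs k)).1,
      le_of_tendsto' (hf k) fun n => (cfApprox_mem_Icc n _ (hs k)).2⟩
  have hrec : ∀ k, f k = 1 / (a k + f (k + 1)) := by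
    intro k
    have h1 := (tendsto_add_atTop_iff_nat 1).2 (hf k)
    have ha' : (1 : ℝ) ≤ a k := by exact_mod_cast ha k
    have h2 : Tendsto (fun n => 1 / (a k + cfApprox n (shift (k + 1)))) atTop
        (𝓝 (1 / (a k + f (k + 1)))) :=
      tendsto_const_nhds.div ((hf (k + 1)).const_add _) (by linarith [hmem (k + 1)])
    refine tendsto_nhds_unique h1 (h2.congr fun n => ?_)
    simp only [cfApprox, shift, zero_add]
    congr 4
    ext i
    congr 1
    omega
  have hpos : ∀ k, 0 < f k := fun k => by
    rw [hrec]; exact (one_div_add_mem_Ioc (ha k) (hmem _).1).1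
  -- Strictness needs positivity of the next tail; with it, floor and fractional part of `(f k)⁻¹`
  -- are exactly `a k` and `f (k + 1)`.
  have hlt : ∀ k, f k < 1 := fun k => by
    rw [hrec]; exact one_div_add_lt_one (ha k) (hpos _)
  have hdig : ∀ n k, cfDigit (f k) n = some (a (k + n)) := by
    intro n
    induction n with
    | zero =>
      intro k
      rw [cfDigit_head (hpos k) (hlt k), hrec, one_div, inv_inv,
        (floor_fract_add_of_mem_Ico _ (hmem _).1 (hlt _)).1, add_zero]
    | succ n ih =>
      intro k
      rw [cfDigit_tail (hpos k) (hlt k), hrec, one_div, inv_inv,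
        (floor_fract_add_of_mem_Ico _ (hmem _).1 (hlt _)).2, ih]
      congr 2; omega
  exact ⟨f 0, (hmem 0).1, hlt 0, fun n => by rw [hdig, zero_add]⟩

theorem infiniteCF_eq_of {x : ℝ} (h0 : 0 ≤ x) (h1 : x < 1) {a : ℕ → ℕ} (ha : ∀ i, 1 ≤ a i)
    (h : ∀ n, cfDigit x n = some (a n)) : infiniteCF a = GenContFract.of x := by
  have hs : (infiniteCF a).s = (GenContFract.of x).s := by
    apply Stream'.Seq.ext
    intro n
    have hn := h n
    simp only [cfDigit, Option.map_eq_some_iff] at hn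
    obtain ⟨b, hb, hba⟩ := hn
    obtain ⟨p, hp, rfl⟩ := GenContFract.exists_s_b_of_partDen hb
    obtain ⟨h1, z, hz⟩ := GenContFract.of_partNum_eq_one_and_exists_int_partDen_eq hp
    have hz' : p.b = a n := by
      rw [hz] at hba ⊢
      have := ha n
      rw [← hba] at this ⊢
      rw [natCast_floor_eq_intCast_floor, Int.floor_intCast]
      -- `cfDigit` uses the natural floor, which sends a negative partial denominator to `0`;
      -- positivity of `a n` rules this out.
      by_contra hneg
      rw [Nat.floor_of_nonpos (not_le.1 hneg).le] at this
      omega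
    rw [hp]
    obtain ⟨pa, pb⟩ := p
    simp only at h1 hz'
    subst h1 hz'
    rfl
  have hh : (infiniteCF a).h = (GenContFract.of x).h := by
    rw [GenContFract.of_h_eq_floor, Int.floor_eq_zero_iff.2 ⟨h0, h1⟩]
    simp [infiniteCF]
  exact GenContFract.ext hh hs

theorem tendsto_convs_infiniteCF {x : ℝ} (h0 : 0 ≤ x) (h1 : x < 1) {a : ℕ → ℕ}
    (ha : ∀ i, 1 ≤ a i) (h : ∀ n, cfDigit x n = some (a n)) :
    Tendsto (infiniteCF a).convs atTop (𝓝 x) := by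
  rw [infiniteCF_eq_of h0 h1 ha h]
  exact GenContFract.of_convergence x

/-! ### Occurrences of a block in a word -/

/-- The number of occurrences of the block `d` in the word `w` (for nonempty `d`). -/
def occ (d : List ℕ) : List ℕ → ℕ
  | [] => 0
  | a :: w => (if d <+: a :: w then 1 else 0) + occ d w

/-- Only occurrences that straddle the junction are gained. The minimum with `u.length` makes the
induction work: it grows by one exactly when the lengthened `u` is still shorter than or as long as
`d`, and an occurrence starting at the new letter can be new only if it is shorter. -/
theorem occ_append_bounds (d u v : List ℕ) :
    occ d u + occ d v ≤ occ d (u ++ v) ∧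
      occ d (u ++ v) ≤ occ d u + occ d v + min u.length d.length := by
  induction u with
  | nil => simp [occ]
  | cons a u ih =>
    simp only [List.cons_append, occ, List.length_cons]
    have h1 : d <+: a :: u → d <+: a :: (u ++ v) := fun h =>
      h.trans ⟨v, by simp⟩
    have h2 : d.length ≤ u.length + 1 → d <+: a :: (u ++ v) → d <+: a :: u := fun hl h =>
      List.prefix_of_prefix_length_le h ⟨v, by simp⟩ (by simpa using hl)
    by_cases hl : d.length ≤ u.length + 1
    · have : (d <+: a :: (u ++ v)) ↔ d <+: a :: u := ⟨h2 hl, h1⟩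
      simp only [this]
      omega
    · split_ifs with h3 h4
      · omega
      · exact absurd (h1 h3) h4
      · omega
      · omega

theorem occ_le_length (d w : List ℕ) : occ d w ≤ w.length := by
  induction w with
  | nil => simp [occ]
  | cons a w ih => simp only [occ, List.length_cons]; split_ifs <;> omega

theorem occ_eq_card (d w : List ℕ) :
    occ d w = ((Finset.range w.length).filter fun j => d <+: w.drop j).card := by
  induction w with
  | nil => simp [occ]
  | cons a w ih =>
    rw [occ, ih, Finset.card_filter, Finset.card_filter, List.length_cons, Finset.sum_range_succ']
    simp [add_comm]

theorem prefix_drop_map_range_iff (d : List ℕ) (a : ℕ → ℕ) (n j : ℕ) (hd : d ≠ []) :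
    d <+: ((List.range n).map a).drop j ↔
      j + d.length ≤ n ∧ ∀ t < d.length, some (a (j + t)) = d[t]? := by
  have hpos := List.length_pos_iff.2 hd
  constructor
  · intro h
    have hl := h.length_le
    simp only [List.length_drop, List.length_map, List.length_range] at hl
    have hjn : j + d.length ≤ n := by omega
    refine ⟨hjn, fun t ht => ?_⟩
    have := List.prefix_iff_getElem?.1 h t ht
    rw [List.getElem?_eq_getElem ht, ← this]
    simp [List.getElem?_range (show j + t < n by omega)]
  · rintro ⟨hjn, h⟩
    refine List.prefix_iff_getElem?.2 fun t ht => ?_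
    rw [← List.getElem?_eq_getElem ht, ← h t ht]
    simp [List.getElem?_range (show j + t < n by omega)]

theorem blockCount_eq_occ {x : ℝ} {a : ℕ → ℕ} (h : ∀ n, cfDigit x n = some (a n)) {d : List ℕ}
    (hd : d ≠ []) (n : ℕ) : blockCount x d n = occ d ((List.range n).map a) := by
  rw [occ_eq_card, blockCount]
  simp only [List.length_map, List.length_range, prefix_drop_map_range_iff d a n _ hd, h]

/-- The deviation of the number of occurrences of `d` in a prefix of a concatenation of words is
controlled by the deviations in the single words. -/
theorem abs_occ_take_flatten_le (d : List ℕ) {p : ℝ} (hp0 : 0 ≤ p) (hp1 : p ≤ 1) (m : ℕ)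
    (B : List (List ℕ)) (hB : ∀ w ∈ B, w.length ≤ m) (n : ℕ) (hn : n ≤ B.flatten.length) :
    |(occ d (B.flatten.take n) : ℝ) - p * n| ≤
      (B.map fun w => |(occ d w : ℝ) - p * w.length| + d.length).sum + m := by
  induction B generalizing n with
  | nil =>
    simp only [List.flatten_nil, List.length_nil, nonpos_iff_eq_zero] at hn
    simp [hn, occ]
  | cons w B ih =>
    have hS : 0 ≤ (B.map fun w => |(occ d w : ℝ) - p * w.length| + d.length).sum :=
      List.sum_nonneg (by
        simp only [List.mem_map]
        rintro _ ⟨w, -, rfl⟩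
        positivity)
    have hw := hB w List.mem_cons_self
    simp only [List.flatten_cons, List.map_cons, List.sum_cons, List.length_append] at hn ⊢
    rcases le_total n w.length with hle | hle
    · rw [List.take_append_of_le_length hle]
      have h1 : (occ d (w.take n) : ℝ) ≤ n := by
        have := occ_le_length d (w.take n)
        rw [List.length_take, min_eq_left hle] at this
        exact_mod_cast this
      have h2 : (n : ℝ) ≤ m := by exact_mod_cast hle.trans hw
      have h3 : (0 : ℝ) ≤ occ d (w.take n) := Nat.cast_nonneg _
      -- The cut falls inside this word: the count and `p * n` both lie in `[0, m]`.
      have h4 : |(occ d (w.take n) : ℝ) - p * n| ≤ m := by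
        rw [abs_le]
        constructor <;> nlinarith
      have h5 : (0 : ℝ) ≤ |(occ d w : ℝ) - p * w.length| + d.length := by positivity
      linarith
    · obtain ⟨r, rfl⟩ := Nat.exists_eq_add_of_le hle
      rw [List.take_length_add_append]
      have hih := ih (fun w hw => hB w (List.mem_cons_of_mem _ hw)) r (by omega)
      obtain ⟨b1, b2⟩ := occ_append_bounds d w (B.flatten.take r)
      have b3 := b2.trans (Nat.add_le_add_left (min_le_right _ _) _)
      have b1' : (occ d w + occ d (B.flatten.take r) : ℝ) ≤
        occ d (w ++ B.flatten.take r) := by exact_mod_cast b1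
      have b3' : (occ d (w ++ B.flatten.take r) : ℝ) ≤
        occ d w + occ d (B.flatten.take r) + d.length := by exact_mod_cast b3
      have h1 := abs_le.1 hih
      have h2 := abs_le.1 (le_refl |(occ d w : ℝ) - p * w.length|)
      push_cast
      rw [abs_le]
      constructor <;> linarith [h1.1, h1.2, h2.1, h2.2]

/-! ### A martingale on the tree of words -/

/-- `G` solves a Poisson equation: its mean over the two children is `G` minus the centred indicator
of "starts with `d`". Let `u` be `d` with its first digit lowered by one, or deleted if it is `1`.
Exactly one child of a word starts with `d` if the word starts with `u`, and none otherwise. Hence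
`G_d = 1_d + G_u / 2` works by induction on the digit sum. -/
theorem exists_prefix_potential (m : ℕ) : ∀ d : List ℕ, (∀ a ∈ d, 1 ≤ a) → d.sum = m →
    ∃ G : List ℕ → ℝ, (∀ w, 0 ≤ G w ∧ G w ≤ 2) ∧ ∀ a t, 1 ≤ a →
      G ((a + 1) :: t) + G (1 :: a :: t) =
        2 * (G (a :: t) - (if d <+: a :: t then 1 else 0) + (1 / 2) ^ m) := by
  induction m with
  | zero =>
    intro d hd hm
    have : d = [] := by
      rcases d with _ | ⟨b, d⟩
      · rfl
      · have := hd b List.mem_cons_self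
        simp only [List.sum_cons] at hm
        omega
    subst this
    exact ⟨fun _ => 0, by simp, by simp⟩
  | succ m ih =>
    intro d hd hm
    obtain ⟨u, hu, hum, hstep⟩ : ∃ u : List ℕ, (∀ a ∈ u, 1 ≤ a) ∧ u.sum = m ∧ ∀ a t, 1 ≤ a →
        (if d <+: (a + 1) :: t then (1 : ℝ) else 0) + (if d <+: 1 :: a :: t then 1 else 0) =
          if u <+: a :: t then 1 else 0 := by
      rcases d with _ | ⟨b, d⟩
      · simp at hm
      have hd' : ∀ a ∈ d, 1 ≤ a := fun a ha => hd a (List.mem_cons_of_mem _ ha)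
      have hb := hd b List.mem_cons_self
      simp only [List.sum_cons] at hm
      rcases hb.eq_or_lt with rfl | hb
      · refine ⟨d, hd', by omega, fun a t ha => ?_⟩
        have : ¬ (a = 0) := by omega
        simp [List.cons_prefix_cons, this]
      · obtain ⟨c, rfl⟩ : ∃ c, b = c + 1 := ⟨b - 1, by omega⟩
        refine ⟨c :: d, ?_, by simp only [List.sum_cons]; omega, fun a t ha => ?_⟩
        · intro a ha
          rcases List.mem_cons.1 ha with rfl | ha
          · omega
          · exact hd' a ha
        · have : ¬ (c = 0) := by omega
          simp [List.cons_prefix_cons, this]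
    obtain ⟨G, hG, hGs⟩ := ih u hu hum
    refine ⟨fun w => (if d <+: w then 1 else 0) + G w / 2, fun w => ?_, fun a t ha => ?_⟩
    · have := hG w
      dsimp only
      split_ifs <;> constructor <;> linarith
    · have h1 := hGs a t ha
      have h2 := hstep a t ha
      simp only
      rw [pow_succ]
      linarith

theorem exists_occ_martingale (d : List ℕ) (hd : ∀ a ∈ d, 1 ≤ a) :
    ∃ M : List ℕ → ℝ,
      (∀ w, |(occ d w : ℝ) - 1 / 2 ^ d.sum * w.length| ≤ |M w| + 2) ∧ |M [2]| ≤ 1 ∧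
      ∀ a t, 1 ≤ a → M ((a + 1) :: t) + M (1 :: a :: t) = 2 * M (a :: t) ∧
        |M ((a + 1) :: t) - M (a :: t)| ≤ 1 := by
  obtain ⟨G, hG, hGs⟩ := exists_prefix_potential d.sum d hd rfl
  have hp0 : (0 : ℝ) ≤ 1 / 2 ^ d.sum := by positivity
  have hp1 : (1 : ℝ) / 2 ^ d.sum ≤ 1 := by
    rw [div_le_one (by positivity)]; exact one_le_pow₀ one_le_two
  -- The head digit may still grow, so only the tail is counted. With probability `1/2` the head is
  -- frozen and contributes its indicator minus `p`; the drift of `G / 2` cancels this.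
  refine ⟨fun w => occ d w.tail - 1 / 2 ^ d.sum * w.tail.length + G w / 2, fun w => ?_, ?_,
    fun a t ha => ⟨?_, ?_⟩⟩
  · have hg := hG w
    set M : ℝ := occ d w.tail - 1 / 2 ^ d.sum * w.tail.length + G w / 2 with hM
    have h1 := abs_le.1 (le_refl |M|)
    have h2 : |(occ d w : ℝ) - 1 / 2 ^ d.sum * w.length - M| ≤ 2 := by
      rw [hM]
      cases w with
      | nil =>
        simp only [occ, List.tail_nil, List.length_nil]
        rw [abs_le]
        constructor <;> push_cast <;> linarith
      | cons a w =>
        simp only [occ, List.tail_cons, List.length_cons]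
        rw [abs_le]
        split_ifs <;> constructor <;> push_cast <;> linarith
    have h3 := abs_le.1 h2
    rw [abs_le]
    constructor <;> linarith [h1.1, h1.2, h3.1, h3.2]
  · have hg := hG [2]
    simp only [List.tail_cons, occ, List.length_nil]
    rw [abs_le]
    constructor <;> push_cast <;> linarith
  · have h := hGs a t ha
    simp only [List.tail_cons, occ, List.length_cons]
    rw [one_div_pow] at h
    push_cast
    linarith
  · have h1 := hG ((a + 1) :: t)
    have h2 := hG (a :: t)
    simp only [List.tail_cons]
    rw [abs_le]
    constructor <;> linarith

/-! ### Expansions of the rationals in the Kepler tree -/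

theorem of_fract_s (q : ℚ) : (GenContFract.of (Int.fract q)).s = (GenContFract.of q).s := by
  by_cases hq : Int.fract q = 0
  · obtain ⟨a, rfl⟩ : ∃ a : ℤ, q = a := ⟨⌊q⌋, eq_of_sub_eq_zero hq⟩
    rw [hq, GenContFract.of_s_of_int]
    exact_mod_cast GenContFract.of_s_of_int ℚ 0
  · apply Stream'.Seq.ext
    intro n
    cases n with
    | zero =>
      have h1 := GenContFract.of_s_head hq
      have h2 := GenContFract.of_s_head (v := Int.fract q) (by rwa [Int.fract_fract])
      simp only [Stream'.Seq.head, Int.fract_fract] at h1 h2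
      rw [h1, h2]
    | succ n => simp only [GenContFract.of_s_succ, Int.fract_fract]

theorem cfExpansion_cons {q : ℚ} (h0 : 0 < q) (h1 : q < 1) :
    cfExpansion q = ⌊q⁻¹⌋₊ :: cfExpansion (Int.fract q⁻¹) := by
  have hf : Int.fract q = q := Int.fract_eq_self.2 ⟨h0.le, h1⟩
  have hn : (0 : ℚ) ≤ q⁻¹ := (inv_pos.2 h0).le
  apply List.ext_getElem?
  intro n
  cases n with
  | zero =>
    have h := GenContFract.of_s_head (v := q) (by rw [hf]; exact h0.ne')
    simp only [Stream'.Seq.head, hf] at h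
    simp only [cfExpansion, List.getElem?_map, Stream'.Seq.getElem?_toList, h]
    simp [← natCast_floor_eq_intCast_floor hn]
  | succ n =>
    simp only [cfExpansion, List.getElem?_map, Stream'.Seq.getElem?_toList,
      GenContFract.of_s_succ, hf, List.getElem?_cons_succ]
    rw [of_fract_s]

/-- The condition `1 < a + x` excludes only `a = 1`, `x = 0`, where the value is `1` and not in `(0,
1)`. -/
theorem cfExpansion_one_div_add {a : ℕ} (ha : 1 ≤ a) {x : ℚ} (h0 : 0 ≤ x) (h1 : x < 1)
    (hax : 1 < a + x) : cfExpansion (1 / (a + x)) = a :: cfExpansion x := by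
  have hfl : ⌊(a + x : ℚ)⌋₊ = a := by
    rw [add_comm, Nat.floor_add_natCast h0, Nat.floor_eq_zero.2 h1, zero_add]
  have hfr : Int.fract (a + x : ℚ) = x := by
    rw [Int.fract_natCast_add, Int.fract_eq_self.2 ⟨h0, h1⟩]
  rw [cfExpansion_cons (by positivity) (by rwa [div_lt_one (by positivity)]), one_div, inv_inv,
    hfl, hfr]

theorem cfExpansion_zero : cfExpansion 0 = [] := by
  apply List.ext_getElem?
  intro n
  have : (GenContFract.of (0 : ℚ)).s = Stream'.Seq.nil := by
    exact_mod_cast GenContFract.of_s_of_int ℚ 0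
  simp [cfExpansion, this]

theorem keplerNode_mem_Ioo (l j : ℕ) : 0 < keplerNode l j ∧ keplerNode l j < 1 := by
  induction l generalizing j with
  | zero => simp only [keplerNode]; norm_num
  | succ l ih =>
    obtain ⟨h0, -⟩ := ih (j / 2)
    have hn : (0 : ℚ) < (keplerNode l (j / 2)).num := by exact_mod_cast Rat.num_pos.2 h0
    have hd : (0 : ℚ) < (keplerNode l (j / 2)).den := by
      exact_mod_cast (keplerNode l (j / 2)).den_pos
    simp only [keplerNode]
    split_ifs
    · exact ⟨by positivity, by rw [div_lt_one (by positivity)]; linarith⟩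
    · exact ⟨by positivity, by rw [div_lt_one (by positivity)]; linarith⟩

theorem keplerNode_succ_even (l j : ℕ) :
    keplerNode (l + 1) (2 * j) = 1 / (1 + (keplerNode l j)⁻¹) := by
  have h0 := (keplerNode_mem_Ioo l j).1
  have hn : ((keplerNode l j).num : ℚ) ≠ 0 := by exact_mod_cast (Rat.num_pos.2 h0).ne'
  have hd : ((keplerNode l j).den : ℚ) ≠ 0 := by exact_mod_cast (keplerNode l j).den_ne_zero
  simp only [keplerNode, Nat.mul_mod_right, if_true, Nat.mul_div_cancel_left j two_pos]
  conv_rhs => rw [← Rat.num_div_den (keplerNode l j)]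
  rw [inv_div]
  field_simp

theorem keplerNode_succ_odd (l j : ℕ) :
    keplerNode (l + 1) (2 * j + 1) = 1 / (1 + keplerNode l j) := by
  have hd : ((keplerNode l j).den : ℚ) ≠ 0 := by exact_mod_cast (keplerNode l j).den_ne_zero
  have h1 : (2 * j + 1) / 2 = j := by omega
  have h2 : ¬ (2 * j + 1) % 2 = 0 := by omega
  simp only [keplerNode, h1, h2, if_false]
  conv_rhs => rw [← Rat.num_div_den (keplerNode l j)]
  field_simp
  rw [add_comm]

/-- The word attached to position `j` of level `l` of the Kepler tree. -/
noncomputable def keplerWord (l j : ℕ) : List ℕ := cfExpansion (keplerNode l j)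

theorem keplerWord_zero (j : ℕ) : keplerWord 0 j = [2] := by
  have := cfExpansion_one_div_add (a := 2) (by norm_num) le_rfl one_pos (by norm_num)
  rw [cfExpansion_zero] at this
  rw [keplerWord, keplerNode, ← this]
  norm_num

/-- The left child of `r` is `1 / (1 + r⁻¹)`, which raises the first digit by one; the right child
is `1 / (1 + r)`, which puts a `1` in front. -/
theorem keplerWord_succ (l j : ℕ) : ∃ a t, 1 ≤ a ∧ keplerWord l j = a :: t ∧
    keplerWord (l + 1) (2 * j) = (a + 1) :: t ∧
    keplerWord (l + 1) (2 * j + 1) = 1 :: a :: t := by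
  obtain ⟨h0, h1⟩ := keplerNode_mem_Ioo l j
  have hq := (one_lt_inv₀ h0).2 h1
  have hfl : 1 ≤ ⌊(keplerNode l j)⁻¹⌋₊ := Nat.le_floor (by simpa using hq.le)
  have hcons := cfExpansion_cons h0 h1
  refine ⟨_, _, hfl, hcons, ?_, ?_⟩
  · have he : 1 + (keplerNode l j)⁻¹ =
        ((⌊(keplerNode l j)⁻¹⌋₊ + 1 : ℕ) : ℚ) + Int.fract (keplerNode l j)⁻¹ := by
      have := Int.floor_add_fract (keplerNode l j)⁻¹
      rw [← natCast_floor_eq_intCast_floor (inv_pos.2 h0).le] at this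
      push_cast
      linarith
    rw [keplerWord, keplerNode_succ_even, he,
      cfExpansion_one_div_add (by omega) (Int.fract_nonneg _) (Int.fract_lt_one _)
        (by rw [← he]; linarith)]
  · rw [keplerWord, keplerNode_succ_odd, ← hcons]
    exact_mod_cast cfExpansion_one_div_add (a := 1) le_rfl h0.le h1 (by push_cast; linarith)

theorem keplerWord_induction {P : ℕ → List ℕ → Prop} (h0 : P 0 [2])
    (hs : ∀ l a t, 1 ≤ a → P l (a :: t) → P (l + 1) ((a + 1) :: t) ∧ P (l + 1) (1 :: a :: t))
    (l j : ℕ) : P l (keplerWord l j) := by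
  induction l generalizing j with
  | zero => rwa [keplerWord_zero]
  | succ l ih =>
    obtain ⟨a, t, ha, h1, h2, h3⟩ := keplerWord_succ l (j / 2)
    have h := hs l a t ha (h1 ▸ ih (j / 2))
    rcases Nat.mod_two_eq_zero_or_one j with hj | hj
    · rw [show j = 2 * (j / 2) by omega, h2]; exact h.1
    · rw [show j = 2 * (j / 2) + 1 by omega, h3]; exact h.2

theorem one_le_of_mem_keplerWord (l j : ℕ) : ∀ a ∈ keplerWord l j, 1 ≤ a := by
  refine keplerWord_induction (P := fun _ w => ∀ a ∈ w, 1 ≤ a) (by simp) ?_ l j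
  intro _ a t ha h
  simp only [List.forall_mem_cons] at h ⊢
  exact ⟨⟨by omega, h.2⟩, le_rfl, h⟩

theorem length_keplerWord_le (l j : ℕ) : (keplerWord l j).length ≤ l + 1 := by
  refine keplerWord_induction (P := fun l w => w.length ≤ l + 1) (by simp) ?_ l j
  intro _ a t ha h
  simp only [List.length_cons] at h ⊢
  omega

/-! ### Sums over a level -/

theorem sum_range_two_mul {A : Type*} [AddCommMonoid A] (f : ℕ → A) (n : ℕ) :
    ∑ j ∈ Finset.range (2 * n), f j = ∑ j ∈ Finset.range n, (f (2 * j) + f (2 * j + 1)) := by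
  induction n with
  | zero => simp
  | succ n ih =>
    rw [show 2 * (n + 1) = 2 * n + 1 + 1 by ring, Finset.sum_range_succ, Finset.sum_range_succ, ih,
      Finset.sum_range_succ, add_assoc]

theorem two_mul_sum_length_keplerWord (l : ℕ) :
    2 * ∑ j ∈ Finset.range (2 ^ l), (keplerWord l j).length = 2 ^ l * (l + 2) := by
  induction l with
  | zero => simp [keplerWord_zero]
  | succ l ih =>
    have : ∀ j, (keplerWord (l + 1) (2 * j)).length + (keplerWord (l + 1) (2 * j + 1)).length =
        2 * (keplerWord l j).length + 1 := by
      intro j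
      obtain ⟨a, t, -, h1, h2, h3⟩ := keplerWord_succ l j
      simp only [h1, h2, h3, List.length_cons]
      ring
    rw [pow_succ', sum_range_two_mul]
    simp only [this]
    rw [Finset.sum_add_distrib, ← Finset.mul_sum, ih]
    simp
    ring

theorem sum_sq_martingale_le {M : List ℕ → ℝ} (h0 : |M [2]| ≤ 1)
    (hM : ∀ a t, 1 ≤ a → M ((a + 1) :: t) + M (1 :: a :: t) = 2 * M (a :: t) ∧
        |M ((a + 1) :: t) - M (a :: t)| ≤ 1) (l : ℕ) :
    ∑ j ∈ Finset.range (2 ^ l), M (keplerWord l j) ^ 2 ≤ 2 ^ l * (l + 1) := by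
  induction l with
  | zero => simpa [keplerWord_zero] using h0
  | succ l ih =>
    -- Siblings carry the values `M ± δ` with `|δ| ≤ 1`, and `(M + δ)² + (M - δ)² = 2M² + 2δ²`.
    have hstep : ∀ j, M (keplerWord (l + 1) (2 * j)) ^ 2 + M (keplerWord (l + 1) (2 * j + 1)) ^ 2 ≤
        2 * M (keplerWord l j) ^ 2 + 2 := by
      intro j
      obtain ⟨a, t, ha, h1, h2, h3⟩ := keplerWord_succ l j
      obtain ⟨e, b⟩ := hM a t ha
      rw [h1, h2, h3, show M (1 :: a :: t) = 2 * M (a :: t) - M ((a + 1) :: t) by linarith]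
      have := (sq_le_one_iff_abs_le_one _).2 b
      linarith
    rw [pow_succ', sum_range_two_mul]
    refine (Finset.sum_le_sum fun j _ => hstep j).trans ?_
    rw [Finset.sum_add_distrib, ← Finset.mul_sum]
    simp only [Finset.sum_const, Finset.card_range, nsmul_eq_mul]
    push_cast
    rw [pow_succ']
    linarith

theorem sum_abs_occ_sub_le (d : List ℕ) (hd : ∀ a ∈ d, 1 ≤ a) (l : ℕ) :
    ∑ j ∈ Finset.range (2 ^ l),
        (|(occ d (keplerWord l j) : ℝ) - 1 / 2 ^ d.sum * (keplerWord l j).length| + d.length) ≤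
      2 ^ l * ((3 + d.length) * √(l + 1)) := by
  obtain ⟨M, h1, h2, h3⟩ := exists_occ_martingale d hd
  have hsq := sum_sq_martingale_le h2 h3 l
  have hs1 : 1 ≤ √((l : ℝ) + 1) := by
    rw [Real.one_le_sqrt]; linarith [Nat.cast_nonneg (α := ℝ) l]
  have hss : √((l : ℝ) + 1) ^ 2 = l + 1 := Real.sq_sqrt (by positivity)
  set r := √((l : ℝ) + 1)
  -- Cauchy–Schwarz turns the second moment into an L¹ bound.
  have habs : ∑ j ∈ Finset.range (2 ^ l), |M (keplerWord l j)| ≤ 2 ^ l * r := by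
    refine abs_le_of_sq_le_sq' ?_ (by positivity) |>.2
    have := sq_sum_le_card_mul_sum_sq (s := Finset.range (2 ^ l))
      (f := fun j => |M (keplerWord l j)|)
    simp only [Finset.card_range, sq_abs] at this
    push_cast at this
    refine this.trans ?_
    rw [mul_pow, hss, sq (2 ^ l : ℝ), mul_assoc]
    gcongr
  calc _ ≤ ∑ j ∈ Finset.range (2 ^ l), (|M (keplerWord l j)| + (2 + d.length)) :=
        Finset.sum_le_sum fun j _ => by linarith [h1 (keplerWord l j)]
    _ ≤ 2 ^ l * r + 2 ^ l * (2 + d.length) := by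
        rw [Finset.sum_add_distrib, Finset.sum_const, Finset.card_range, nsmul_eq_mul]
        push_cast
        gcongr
    _ ≤ _ := by
        rw [← mul_add]
        gcongr
        nlinarith [Nat.cast_nonneg (α := ℝ) d.length]

/-! ### The permuted concatenation -/

/-- The concatenation of the words of the levels `s, …, s + L - 1`. -/
noncomputable def keplerPrefix (π : ∀ l : ℕ, Equiv.Perm (Fin (2 ^ l))) (s L : ℕ) : List ℕ :=
  (List.range L).flatMap fun i => keplerLevelWord π (s + i)

/-- The words of level `l`, in the order given by `π l`. -/
noncomputable def keplerLevelWords (π : ∀ l : ℕ, Equiv.Perm (Fin (2 ^ l))) (l : ℕ) :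
    List (List ℕ) :=
  (List.finRange (2 ^ l)).map fun j => keplerWord l (π l j)

/-- The words of the levels `s, …, s + L - 1`, in the order of their concatenation. -/
noncomputable def keplerWords (π : ∀ l : ℕ, Equiv.Perm (Fin (2 ^ l))) (s L : ℕ) :
    List (List ℕ) :=
  (List.range L).flatMap fun i => keplerLevelWords π (s + i)

section

variable (π : ∀ l : ℕ, Equiv.Perm (Fin (2 ^ l))) (s : ℕ)

theorem flatten_keplerLevelWords (l : ℕ) :
    (keplerLevelWords π l).flatten = keplerLevelWord π l := rfl

theorem keplerPrefix_succ (L : ℕ) :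
    keplerPrefix π s (L + 1) = keplerPrefix π s L ++ keplerLevelWord π (s + L) := by
  simp [keplerPrefix, List.range_succ]

theorem keplerWords_succ (L : ℕ) :
    keplerWords π s (L + 1) = keplerWords π s L ++ keplerLevelWords π (s + L) := by
  simp [keplerWords, List.range_succ]

theorem flatten_keplerWords (L : ℕ) : (keplerWords π s L).flatten = keplerPrefix π s L := by
  induction L with
  | zero => rfl
  | succ L ih =>
    rw [keplerWords_succ, List.flatten_append, ih, flatten_keplerLevelWords, keplerPrefix_succ]

/-- The permutation drops out here, by reindexing along `π l`. -/
theorem sum_map_keplerLevelWords {A : Type*} [AddCommMonoid A] (f : List ℕ → A) (l : ℕ) :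
    ((keplerLevelWords π l).map f).sum = ∑ j ∈ Finset.range (2 ^ l), f (keplerWord l j) := by
  rw [keplerLevelWords, List.map_map, ← Fin.sum_univ_def]
  exact (Equiv.sum_comp (π l) fun j : Fin (2 ^ l) => f (keplerWord l j)).trans
    (Fin.sum_univ_eq_sum_range (fun j => f (keplerWord l j)) (2 ^ l))

theorem two_mul_length_keplerLevelWord (l : ℕ) :
    2 * (keplerLevelWord π l).length = 2 ^ l * (l + 2) := by
  rw [← flatten_keplerLevelWords, List.length_flatten, sum_map_keplerLevelWords,
    two_mul_sum_length_keplerWord]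

theorem keplerPrefix_prefix {L L' : ℕ} (h : L ≤ L') :
    keplerPrefix π s L <+: keplerPrefix π s L' := by
  induction L', h using Nat.le_induction with
  | base => exact List.prefix_rfl
  | succ L' _ ih => rw [keplerPrefix_succ]; exact ih.trans (List.prefix_append _ _)

theorem le_length_keplerPrefix (L : ℕ) : L ≤ (keplerPrefix π s L).length := by
  induction L with
  | zero => simp
  | succ L ih =>
    have h := two_mul_length_keplerLevelWord π (s + L)
    have : 0 < 2 ^ (s + L) * (s + L + 2) := by positivity
    rw [keplerPrefix_succ, List.length_append]
    omega

theorem getElem?_keplerPrefix {L n : ℕ} (h : n < (keplerPrefix π s L).length) :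
    (keplerPrefix π s L)[n]? = some (keplerDigits π s n) := by
  have h1 : n < (keplerPrefix π s (n + 1)).length := le_length_keplerPrefix π s (n + 1)
  have h2 : (keplerPrefix π s (n + 1))[n]? = some (keplerDigits π s n) := by
    change _ = some ((keplerPrefix π s (n + 1)).getD n 0)
    rw [List.getD_eq_getElem _ _ h1, List.getElem?_eq_getElem h1]
  rcases le_total L (n + 1) with hL | hL
  · rw [← h2, List.getElem?_eq_getElem h,
      List.prefix_iff_getElem?.1 (keplerPrefix_prefix π s hL) n h]
  · rw [← h2, List.getElem?_eq_getElem h1,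
      List.prefix_iff_getElem?.1 (keplerPrefix_prefix π s hL) n h1]

theorem map_keplerDigits_range {L n : ℕ} (h : n ≤ (keplerPrefix π s L).length) :
    (List.range n).map (keplerDigits π s) = (keplerPrefix π s L).take n := by
  apply List.ext_getElem?
  intro i
  by_cases hi : i < n
  · rw [List.getElem?_take_of_lt hi, getElem?_keplerPrefix π s (hi.trans_le h)]
    simp [List.getElem?_range hi]
  · rw [List.getElem?_eq_none (by simp; omega), List.getElem?_eq_none (by simp; omega)]

theorem one_le_keplerDigits (n : ℕ) : 1 ≤ keplerDigits π s n := by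
  have h := getElem?_keplerPrefix π s (le_length_keplerPrefix π s (n + 1))
  have hm := List.mem_of_getElem? h
  simp only [keplerPrefix, keplerLevelWord, List.mem_flatMap] at hm
  obtain ⟨i, -, j, -, hj⟩ := hm
  exact one_le_of_mem_keplerWord _ _ _ hj

theorem length_le_of_mem_keplerWords {L : ℕ} {w : List ℕ} (h : w ∈ keplerWords π s (L + 1)) :
    w.length ≤ s + L + 1 := by
  simp only [keplerWords, keplerLevelWords, List.mem_flatMap, List.mem_range, List.mem_map] at h
  obtain ⟨i, hi, j, -, rfl⟩ := h
  exact (length_keplerWord_le _ _).trans (by omega)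

/-! ### Block frequencies along the concatenation -/

theorem sum_deviation_keplerWords_le (d : List ℕ) (hd : ∀ a ∈ d, 1 ≤ a) (L : ℕ) :
    ((keplerWords π s L).map fun w =>
        |(occ d w : ℝ) - 1 / 2 ^ d.sum * w.length| + d.length).sum ≤
      2 ^ (s + L) * ((3 + d.length) * √((s + L : ℕ) + 1)) := by
  induction L with
  | zero => simp only [keplerWords, List.range_zero, List.flatMap_nil, List.map_nil,
      List.sum_nil]; positivity
  | succ L ih =>
    rw [keplerWords_succ, List.map_append, List.sum_append, sum_map_keplerLevelWords]
    refine (add_le_add ih (sum_abs_occ_sub_le d hd (s + L))).trans ?_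
    -- The bound for all earlier levels has the same form as that for the new level, so the total
    -- doubles; this is the geometric sum.
    rw [← two_mul, ← mul_assoc, ← pow_succ', add_assoc s L 1]
    have hr : √(((s + L : ℕ) : ℝ) + 1) ≤ √(((s + (L + 1) : ℕ) : ℝ) + 1) :=
      Real.sqrt_le_sqrt (by push_cast; linarith)
    exact mul_le_mul_of_nonneg_left (mul_le_mul_of_nonneg_left hr (by positivity))
      (by positivity)

theorem abs_occ_keplerDigits_sub_le (d : List ℕ) (hd : ∀ a ∈ d, 1 ≤ a) {L n : ℕ} (hL : 1 ≤ L)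
    (h1 : (keplerPrefix π s L).length ≤ n) (h2 : n ≤ (keplerPrefix π s (L + 1)).length) :
    |(occ d ((List.range n).map (keplerDigits π s)) : ℝ) - 1 / 2 ^ d.sum * n| ≤
      8 * (7 + 2 * d.length) / √(L + 1) * n := by
  have hp0 : (0 : ℝ) ≤ 1 / 2 ^ d.sum := by positivity
  have hp1 : (1 : ℝ) / 2 ^ d.sum ≤ 1 := by
    rw [div_le_one (by positivity)]; exact one_le_pow₀ one_le_two
  rw [map_keplerDigits_range π s h2, ← flatten_keplerWords]
  have key := (abs_occ_take_flatten_le d hp0 hp1 (s + L + 1) (keplerWords π s (L + 1))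
    (fun w hw => length_le_of_mem_keplerWords π s hw) n
    (by rwa [flatten_keplerWords])).trans
      (add_le_add_left (sum_deviation_keplerWords_le π s d hd (L + 1)) _)
  refine key.trans ?_
  obtain ⟨L, rfl⟩ : ∃ k, L = k + 1 := ⟨L - 1, by omega⟩
  -- The last complete level alone already makes `n` large compared with the deviation, even though
  -- the latter includes the whole unfinished level.
  have hn : 2 ^ (s + L) * (s + L + 2) ≤ 2 * n := by
    rw [← two_mul_length_keplerLevelWord π (s + L)]
    rw [keplerPrefix_succ, List.length_append] at h1
    omega
  have hn' : (2 : ℝ) ^ (s + L) * (s + L + 2) ≤ 2 * n := by exact_mod_cast hn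
  have hl : s + L + 2 ≤ 2 * 2 ^ (s + L) := by
    have := Nat.lt_two_pow_self (n := s + L + 1)
    rw [pow_succ'] at this
    omega
  have hl' : (s + L + 2 : ℝ) ≤ 2 * 2 ^ (s + L) := by exact_mod_cast hl
  have hr : √(s + L + 3 : ℝ) ≤ 2 * √(s + L + 2 : ℝ) := by
    rw [show (2 : ℝ) = √(2 ^ 2) by rw [Real.sqrt_sq (by norm_num)], ← Real.sqrt_mul (by norm_num),
      Real.sqrt_sq (by norm_num)]
    exact Real.sqrt_le_sqrt (by nlinarith [Nat.cast_nonneg (α := ℝ) s, Nat.cast_nonneg (α := ℝ) L])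
  have hrL : √((L + 1 : ℕ) + 1 : ℝ) ≤ √(s + L + 2 : ℝ) := by
    apply Real.sqrt_le_sqrt
    push_cast
    linarith [Nat.cast_nonneg (α := ℝ) s]
  have hr0 : 0 < √((L + 1 : ℕ) + 1 : ℝ) := by positivity
  have hr1 : 1 ≤ √(s + L + 2 : ℝ) := by
    rw [Real.one_le_sqrt]
    linarith [Nat.cast_nonneg (α := ℝ) s, Nat.cast_nonneg (α := ℝ) L]
  have hrr : √(s + L + 2 : ℝ) * √(s + L + 2 : ℝ) = s + L + 2 := Real.mul_self_sqrt (by positivity)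
  have hcast : √(((s + (L + 1 + 1) : ℕ) : ℝ) + 1) = √(s + L + 3 : ℝ) := by
    congr 1; push_cast; ring
  rw [hcast]
  generalize √((L + 1 : ℕ) + 1 : ℝ) = r at *
  generalize √(s + L + 2 : ℝ) = R at *
  generalize √(s + L + 3 : ℝ) = R' at *
  have hk : (0 : ℝ) ≤ d.length := Nat.cast_nonneg _
  generalize (d.length : ℝ) = k at *
  have hP : (0 : ℝ) < 2 ^ (s + L) := by positivity
  have e1 : (2 : ℝ) ^ (s + (L + 1 + 1)) = 4 * 2 ^ (s + L) := by
    rw [← add_assoc, ← add_assoc, pow_succ, pow_succ]; ring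
  rw [e1]
  push_cast
  generalize (2 : ℝ) ^ (s + L) = P at *
  have b1 : 4 * P * ((3 + k) * R') + (s + (L + 1) + 1) ≤ (26 + 8 * k) * (P * R) := by
    have : 4 * P * ((3 + k) * R') ≤ 4 * P * ((3 + k) * (2 * R)) := by gcongr
    nlinarith
  have b2 : P * R * r ≤ 2 * n := by
    calc P * R * r ≤ P * R * R := by gcongr
      _ = P * (s + L + 2) := by rw [mul_assoc, hrr]
      _ ≤ _ := hn'
  have b3 : P * R ≤ 2 * n / r := by rwa [le_div_iff₀ hr0]
  have b4 : (0 : ℝ) ≤ n / r := by positivity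
  calc _ ≤ (26 + 8 * k) * (P * R) := b1
    _ ≤ (26 + 8 * k) * (2 * n / r) := by gcongr
    _ = (52 + 16 * k) * (n / r) := by ring
    _ ≤ 8 * (7 + 2 * k) * (n / r) := by gcongr; linarith
    _ = _ := by ring

theorem exists_keplerPrefix_length_bounds {L₀ n : ℕ} (hL : 1 ≤ L₀)
    (hn : (keplerPrefix π s L₀).length ≤ n) :
    ∃ L, L₀ ≤ L ∧ (keplerPrefix π s L).length ≤ n ∧ n ≤ (keplerPrefix π s (L + 1)).length := by
  classical
  have hex : ∃ L, n < (keplerPrefix π s (L + 1)).length :=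
    ⟨n, le_length_keplerPrefix π s (n + 1)⟩
  have hle : L₀ ≤ Nat.find hex := by
    by_contra! hlt
    have h1 := Nat.find_spec hex
    have h2 := (keplerPrefix_prefix π s (Nat.succ_le_of_lt hlt)).length_le
    simp only [Nat.succ_eq_add_one] at h2
    omega
  refine ⟨Nat.find hex, hle, ?_, (Nat.find_spec hex).le⟩
  have := Nat.find_min hex (m := Nat.find hex - 1) (by omega)
  rw [Nat.sub_add_cancel (hL.trans hle)] at this
  exact not_lt.1 this

theorem tendsto_occ_keplerDigits (d : List ℕ) (hd : ∀ a ∈ d, 1 ≤ a) :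
    Tendsto (fun n : ℕ => (occ d ((List.range n).map (keplerDigits π s)) : ℝ) / n) atTop
      (𝓝 (1 / 2 ^ d.sum)) := by
  have hlim : Tendsto (fun L : ℕ => 8 * (7 + 2 * (d.length : ℝ)) / √((L : ℝ) + 1)) atTop (𝓝 0) :=
    tendsto_const_nhds.div_atTop (Real.tendsto_sqrt_atTop.comp
      (tendsto_atTop_add_const_right _ _ tendsto_natCast_atTop_atTop))
  rw [Metric.tendsto_atTop]
  intro ε hε
  obtain ⟨L₀, hL₀⟩ := eventually_atTop.1 (hlim.eventually (gt_mem_nhds hε))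
  refine ⟨(keplerPrefix π s (max L₀ 1)).length, fun n hn => ?_⟩
  obtain ⟨L, hL, h1, h2⟩ := exists_keplerPrefix_length_bounds π s (le_max_right L₀ 1) hn
  have hL1 := (le_max_right L₀ 1).trans hL
  have hn0 : (0 : ℝ) < n := by
    exact_mod_cast (hL1.trans (le_length_keplerPrefix π s L)).trans h1
  have key := abs_occ_keplerDigits_sub_le π s d hd hL1 h1 h2
  rw [Real.dist_eq, div_sub' hn0.ne', abs_div, abs_of_pos hn0, div_lt_iff₀ hn0, mul_comm (n : ℝ)]
  refine key.trans_lt ?_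
  gcongr
  exact hL₀ L ((le_max_left L₀ 1).trans hL)

end

/-- `s = 1` gives `𝒦^π`. With `s = 0` the concatenation begins with level `0`, whose only word is
`[2]`. -/
theorem mainTheorem2 (π : ∀ l : ℕ, Equiv.Perm (Fin (2 ^ l))) (s : ℕ) (hs : s = 0 ∨ s = 1) :
    ∃ x : ℝ,
      Tendsto (infiniteCF (keplerDigits π s)).convs atTop (𝓝 x) ∧
      (∀ n : ℕ, cfDigit x n = some (keplerDigits π s n)) ∧
      IsMinkowskiNormal x := by
  have ha := one_le_keplerDigits π s
  obtain ⟨x, h0, h1, hx⟩ := exists_cfDigit_eq (keplerDigits π s) ha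
  refine ⟨x, tendsto_convs_infiniteCF h0 h1 ha hx, hx, ⟨h0, h1⟩, fun d hd hpos => ?_⟩
  have hμ := minkowskiMeasure_cfCylinder d hpos
  refine ⟨?_, hμ⟩
  rw [hμ]
  simpa only [blockCount_eq_occ hx hd] using tendsto_occ_keplerDigits π s d hpos
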